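/- Let $\lambda$ be an infinite cardinal, let $\mathcal{A}$ be an abelian category satisfying $AB4^*(\lambda)$ (that is, $\mathcal{A}$ has all products of fewer than $\lambda$ objects, and every product of fewer than $\lambda$ exact sequences in $\mathcal{A}$ is exact), and let $\mathcal{J}$ be a small category whose set of all morphisms has cardinality $<\lambda$. For a functor $F:\mathcal{J}^{op}\to\mathcal{A}$ let $N_\bullet(F)$ be the (Roos) complex $N_0(F)\to N_1(F)\to N_2(F)\to\cdots$ with $$N_k(F)=\prod_{i_0\to i_1\to\cdots\to i_k}F(i_0),$$ the product being over all $k$-simplices of the nerve of $\mathcal{J}$, and with differential $\partial_k=\sum_{j=0}^{k+1}(-1)^j\partial_k^j:N_k(F)\to N_{k+1}(F)$. Here, for $j>0$, the component of $\partial_k^j$ at $i_0\to\cdots\to i_{k+1}$ is the projection to the factor indexed by the $j$-th face of this simplex, and for $j=0$ it is the projection to the factor indexed by $i_1\to\cdots\to i_{k+1}$ followed by $F(i_0\to i_1):F(i_1)\to F(i_0)$. Let $T^n(F)=H^n(N_\bullet(F))$. A connected sequence of functors between abelian categories is a sequence of additive functors $(U^n)_{n\ge 0}$ with connecting morphisms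 $U^n(X'')\to U^{n+1}(X')$, natural in the short exact sequence $0\to X'\to X\to X''\to 0$, such that the composite of any two consecutive maps $U^n(X)\to U^n(X'')\to U^{n+1}(X')\to U^{n+1}(X)$ is zero. It is a $\delta$-functor if all long sequences $0\to U^0(X')\to U^0(X)\to U^0(X'')\to U^1(X')\to\cdots$ are exact. A $\delta$-functor $U$ is universal if for every connected sequence $V$ each natural transformation $U^0\to V^0$ extends uniquely to a sequence of natural transformations $U^n\to V^n$ commuting with all connecting morphisms. Right derived functors of a functor $G$ are a universal $\delta$-functor $(U^n)$ together with a natural isomorphism $U^0\cong G$. Then: 1. $\mathcal{A}$ has all limits of shape $\mathcal{J}^{op}$ and all the products $N_k(F)$, and $N_\bullet$ sends short exact sequences in $\mathcal{A}^{\mathcal{J}^{op}}$ to short exact sequences of complexes. 2. The functor $\lim:\mathcal{A}^{\mathcal{J}^{op}}\to\mathcal{A}$ has right derived functors $\lim^n$, and these are the cohomology of the Roos complex: the functors $T^n$, with the connecting morphisms of the long exact cohomology sequence of $0\to N_\bullet(F')\to N_\bullet(F)\to N_\bullet(F'')\to 0$ and a natural isomorphism $T^0\cong\lim$, are right derived functors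 of $\lim$. Every $T^n$ with $n\ge 1$ is effaceable, i.e. each $F$ admits a monomorphism $u:F\to M$ with $T^n(u)=0$. 3. If $(L^n)$ are any right derived functors of $\lim$, there is a unique family of natural isomorphisms $L^n\cong T^n$ ($n\ge 0$) that commutes with the connecting morphisms and, in degree $0$, with the given isomorphisms $L^0\cong\lim$ and $T^0\cong\lim$. If $\mathcal{A}^{\mathcal{J}^{op}}$ has injective resolutions, then also the derived functors of $\lim$ computed by injective resolutions are naturally isomorphic to the $T^n$. -/

import Mathlib

open CategoryTheory Limits Opposite

universe w v u v' u'

/-! ### Abelian categories satisfying `AB4*(κ)` -/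

/-- `AB4*(κ)`: the category has all products of fewer than `κ` many objects, and any product of
fewer than `κ` many exact sequences `X₁ i ⟶ X₂ i ⟶ X₃ i` is exact. -/
structure SatisfiesAB4Star (κ : Cardinal.{w}) (A : Type u) [Category.{v} A] [Abelian A] :
    Prop where
  hasProducts : ∀ ι : Type w, HasCardinalLT ι κ → HasProductsOfShape ι A
  exact_prod : ∀ (ι : Type w) (hι : HasCardinalLT ι κ) (S : ι → ShortComplex A),
    (∀ i, (S i).Exact) →
      haveI := hasProducts ι hι
      (ShortComplex.mk (Limits.Pi.map fun i => (S i).f) (Limits.Pi.map fun i => (S i).g)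
        (by ext i; simp)).Exact

section Cardinality

variable {κ : Cardinal.{w}} {J : Type w} [SmallCategory J]

theorem hasCardinalLT_obj_of_arrow (hJ : HasCardinalLT (Arrow J) κ) : HasCardinalLT J κ :=
  hJ.of_injective (fun j => Arrow.mk (𝟙 j)) (fun _ _ h => congrArg (fun f : Arrow J => f.left) h)

theorem hasCardinalLT_fin_fun (hκ : Cardinal.aleph0 ≤ κ) {X : Type w} (hX : HasCardinalLT X κ)
    (n : ℕ) : HasCardinalLT (Fin n → X) κ := by
  induction n with
  | zero => exact hasCardinalLT_of_finite _ _ hκ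
  | succ n ih =>
    exact (hasCardinalLT_prod hκ hX ih).of_injective (fun f => (f 0, fun i => f i.succ)) (by
      intro f g h
      funext i
      refine Fin.cases ?_ (fun i => ?_) i
      · exact congrArg Prod.fst h
      · exact congrFun (congrArg Prod.snd h) i)

/-- A category with fewer than `κ` morphisms has fewer than `κ` chains
`i₀ ⟶ i₁ ⟶ ⋯ ⟶ iₙ`. -/
theorem hasCardinalLT_composableArrows (hκ : Cardinal.aleph0 ≤ κ)
    (hJ : HasCardinalLT (Arrow J) κ) (n : ℕ) : HasCardinalLT (ComposableArrows J n) κ := by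
  refine (hasCardinalLT_fin_fun hκ (hasCardinalLT_fin_fun hκ hJ (n + 1)) (n + 1)).of_injective
    (fun x a b => Arrow.mk (x.map (homOfLE (min_le_left a b)))) ?_
  intro x y h
  have hobj : ∀ a, x.obj a = y.obj a := fun a =>
    congrArg (fun f : Arrow J => f.right) (congrFun (congrFun h a) a)
  have hmap : ∀ a b, Arrow.mk (x.map (homOfLE (min_le_left a b))) =
      Arrow.mk (y.map (homOfLE (min_le_left a b))) := fun a b => congrFun (congrFun h a) b
  refine Functor.hext hobj (fun a b f => ?_)
  have key : ∀ (c : Fin (n + 1)) (g : c ⟶ b), c = min b a →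
      HEq (x.map g) (y.map g) := by
    rintro c g rfl
    have h3 : HEq (Arrow.mk (x.map (homOfLE (min_le_left b a)))).hom
        (Arrow.mk (y.map (homOfLE (min_le_left b a)))).hom := by rw [hmap b a]
    have hg : g = homOfLE (min_le_left b a) := Subsingleton.elim _ _
    rw [hg]
    exact h3
  exact key a f (min_eq_right (leOfHom f)).symm

variable {A : Type u} [Category.{v} A] [Abelian A]

theorem SatisfiesAB4Star.hasProductsOfShape_composableArrows (hA : SatisfiesAB4Star κ A)
    (hκ : Cardinal.aleph0 ≤ κ) (hJ : HasCardinalLT (Arrow J) κ) (n : ℕ) :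
    HasProductsOfShape (ComposableArrows J n) A :=
  hA.hasProducts _ (hasCardinalLT_composableArrows hκ hJ n)

theorem SatisfiesAB4Star.hasLimitsOfShape_op (hA : SatisfiesAB4Star κ A)
    (hJ : HasCardinalLT (Arrow J) κ) : HasLimitsOfShape Jᵒᵖ A where
  has_limit F := by
    have : HasProductsOfShape Jᵒᵖ A :=
      hA.hasProducts _ ((hasCardinalLT_obj_of_arrow hJ).of_injective unop unop_injective)
    have : HasProductsOfShape (Σ p : Jᵒᵖ × Jᵒᵖ, p.1 ⟶ p.2) A :=
      hA.hasProducts _ (hJ.of_injective (fun f => Arrow.mk f.2.unop) (by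
        rintro ⟨⟨i, j⟩, f⟩ ⟨⟨i', j'⟩, f'⟩ h
        obtain rfl : i = i' :=
          unop_injective (congrArg (fun f : Arrow J => f.right) h)
        obtain rfl : j = j' :=
          unop_injective (congrArg (fun f : Arrow J => f.left) h)
        have h' : HEq (Arrow.mk f.unop).hom (Arrow.mk f'.unop).hom := by
          rw [show Arrow.mk f.unop = Arrow.mk f'.unop from h]
        exact congrArg (Sigma.mk _) (Quiver.Hom.unop_inj (eq_of_heq h'))))
    exact hasLimit_of_equalizer_and_product F

end Cardinality

/-! ### Connected sequences of functors, `δ`-functors, universality, derived functors -/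

section DeltaFunctors

variable {C : Type u} [Category.{v} C] [Abelian C] {D : Type u'} [Category.{v'} D] [Abelian D]

/-- A functor `F` is effaceable if every object `X` admits a monomorphism `m : X ⟶ M` with
`F.map m = 0`. -/
def IsEffaceable (F : C ⥤ D) : Prop :=
  ∀ X : C, ∃ (M : C) (m : X ⟶ M), Mono m ∧ F.map m = 0

/-- The structure of a (cohomological) connected sequence of functors on a sequence of additive
functors `T n`: natural connecting morphisms, for which the long sequences are complexes. -/
structure ConnectedSequence (T : ℕ → C ⥤ D) [∀ n, (T n).Additive] where
  δ : ∀ (n : ℕ) {S : ShortComplex C}, S.ShortExact → ((T n).obj S.X₃ ⟶ (T (n + 1)).obj S.X₁)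
  comp_δ : ∀ (n : ℕ) {S : ShortComplex C} (hS : S.ShortExact), (T n).map S.g ≫ δ n hS = 0
  δ_comp : ∀ (n : ℕ) {S : ShortComplex C} (hS : S.ShortExact),
    δ n hS ≫ (T (n + 1)).map S.f = 0
  δ_naturality : ∀ (n : ℕ) {S S' : ShortComplex C} (hS : S.ShortExact) (hS' : S'.ShortExact)
    (h : S ⟶ S'), (T n).map h.τ₃ ≫ δ n hS' = δ n hS ≫ (T (n + 1)).map h.τ₁

/-- The structure of a (cohomological) `δ`-functor on a sequence of additive functors `T n`: a
connected sequence of functors such that, for every short exact sequence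
`0 ⟶ X₁ ⟶ X₂ ⟶ X₃ ⟶ 0`, the long sequence
`0 ⟶ T⁰ X₁ ⟶ T⁰ X₂ ⟶ T⁰ X₃ ⟶ T¹ X₁ ⟶ T¹ X₂ ⟶ ⋯` is exact. -/
structure DeltaFunctor (T : ℕ → C ⥤ D) [∀ n, (T n).Additive] extends ConnectedSequence T where
  mono_map_f : ∀ {S : ShortComplex C}, S.ShortExact → Mono ((T 0).map S.f)
  exact₂ : ∀ (n : ℕ) {S : ShortComplex C}, S.ShortExact → (S.map (T n)).Exact
  exact₃ : ∀ (n : ℕ) {S : ShortComplex C} (hS : S.ShortExact),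
    (ShortComplex.mk _ _ (comp_δ n hS)).Exact
  exact₁ : ∀ (n : ℕ) {S : ShortComplex C} (hS : S.ShortExact),
    (ShortComplex.mk _ _ (δ_comp n hS)).Exact

namespace ConnectedSequence

variable {T : ℕ → C ⥤ D} [∀ n, (T n).Additive] {U : ℕ → C ⥤ D} [∀ n, (U n).Additive]

/-- A sequence of natural transformations `T n ⟶ U n` is a morphism of connected sequences (in
particular, of `δ`-functors) if it commutes with all connecting morphisms. -/
def IsMorphism (P : ConnectedSequence T) (Q : ConnectedSequence U) (φ : ∀ n, T n ⟶ U n) : Prop :=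
  ∀ (n : ℕ) (S : ShortComplex C) (hS : S.ShortExact),
    P.δ n hS ≫ (φ (n + 1)).app S.X₁ = (φ n).app S.X₃ ≫ Q.δ n hS

/-- Universality: every natural transformation from the degree zero functor to the degree zero
functor of a connected sequence extends uniquely to a morphism. -/
def IsUniversal (P : ConnectedSequence T) : Prop :=
  ∀ (U : ℕ → C ⥤ D) [∀ n, (U n).Additive] (Q : ConnectedSequence U) (φ₀ : T 0 ⟶ U 0),
    ∃! φ : ∀ n, T n ⟶ U n, φ 0 = φ₀ ∧ P.IsMorphism Q φ

end ConnectedSequence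

/-- The structure of right derived functors of `F` on the sequence `T n`: a universal `δ`-functor
together with a natural isomorphism of its degree zero functor with `F`. -/
structure RightDerivedFunctors (F : C ⥤ D) (T : ℕ → C ⥤ D) [∀ n, (T n).Additive] extends
    DeltaFunctor T where
  universal : toConnectedSequence.IsUniversal
  iso₀ : T 0 ≅ F

end DeltaFunctors

/-! ### The Roos complex -/

section Roos

variable (J : Type w) [SmallCategory J] (A : Type u) [Category.{v} A] [Abelian A]
  [∀ n, HasProductsOfShape (ComposableArrows J n) A]

/-- The product of the `F(i₀)` over all the `n`-simplices `i₀ ⟶ i₁ ⟶ ⋯ ⟶ iₙ` of the nerve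
of `J`. -/
noncomputable abbrev roosObj {J : Type w} [SmallCategory J] {A : Type u} [Category.{v} A]
    [∀ n, HasProductsOfShape (ComposableArrows J n) A] (F : Jᵒᵖ ⥤ A) (n : ℕ) : A :=
  ∏ᶜ fun x : ComposableArrows J n => F.obj (op (x.obj 0))

variable {J A} in
/-- The cosimplicial object `n ↦ ∏ F(i₀)`. For `φ : [m] ⟶ [n]`, the component at the simplex
`y = (i₀ ⟶ ⋯ ⟶ iₙ)` is the projection to the factor of index `φ^* y`, which is `F(i_{φ(0)})`,
followed by `F` of the composite `i₀ ⟶ i_{φ(0)}`. -/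
noncomputable def roosCosimplicialObj (F : Jᵒᵖ ⥤ A) : CosimplicialObject A where
  obj Δ := roosObj F Δ.len
  map {Δ Δ'} φ := Pi.lift fun y : ComposableArrows J Δ'.len =>
    Pi.π (fun x : ComposableArrows J Δ.len => F.obj (op (x.obj 0)))
        (y.whiskerLeft φ.toOrderHom.monotone.functor) ≫
      F.map (y.map (homOfLE (Fin.zero_le (φ.toOrderHom 0)))).op
  map_id Δ := by
    refine Pi.hom_ext _ _ fun y => ?_
    rw [Pi.lift_π, Category.id_comp]
    exact (congrArg (Pi.π (fun x : ComposableArrows J Δ.len => F.obj (op (x.obj 0))) y ≫ ·)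
      ((congrArg (fun f => F.map (Quiver.Hom.op f)) (y.map_id 0)).trans (F.map_id _))).trans
        (Category.comp_id _)
  map_comp {Δ Δ' Δ''} φ ψ := by
    refine Pi.hom_ext _ _ fun y => ?_
    rw [Category.assoc, Pi.lift_π, Pi.lift_π, ← Category.assoc, Pi.lift_π, Category.assoc]
    refine congrArg (Pi.π (fun x : ComposableArrows J Δ.len => F.obj (op (x.obj 0)))
      (y.whiskerLeft (φ ≫ ψ).toOrderHom.monotone.functor) ≫ ·) ?_
    refine Eq.trans (congrArg F.map (Quiver.Hom.unop_inj ?_)) (F.map_comp _ _)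
    exact (congrArg y.map (Subsingleton.elim _ _)).trans (y.map_comp
      (homOfLE (Fin.zero_le (ψ.toOrderHom 0)))
      (homOfLE (ψ.toOrderHom.monotone (Fin.zero_le (φ.toOrderHom 0)))))

variable {J A} in
/-- The morphism `∏ F(i₀) ⟶ ∏ G(i₀)` induced by a natural transformation `F ⟶ G`. -/
noncomputable def roosObjMap {F G : Jᵒᵖ ⥤ A} (α : F ⟶ G) (n : ℕ) : roosObj F n ⟶ roosObj G n :=
  Limits.Pi.map fun x : ComposableArrows J n => α.app (op (x.obj 0))

variable {J A} in
theorem roosObjMap_π {F G : Jᵒᵖ ⥤ A} (α : F ⟶ G) (n : ℕ) (x : ComposableArrows J n) :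
    roosObjMap α n ≫ Pi.π _ x = Pi.π _ x ≫ α.app (op (x.obj 0)) :=
  Pi.map_π _ _

/-- The cosimplicial object `n ↦ ∏ F(i₀)`, functorially in `F`. -/
noncomputable def roosCosimplicial : (Jᵒᵖ ⥤ A) ⥤ CosimplicialObject A where
  obj F := roosCosimplicialObj F
  map {F G} α :=
    { app := fun Δ => roosObjMap α Δ.len
      naturality := fun Δ Δ' φ => by
        refine Pi.hom_ext _ _ fun y => ?_
        dsimp only [roosCosimplicialObj]
        rw [Category.assoc, Category.assoc, Pi.lift_π, roosObjMap_π, ← Category.assoc,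
          ← Category.assoc, Pi.lift_π, roosObjMap_π, Category.assoc, Category.assoc]
        exact congrArg (Pi.π (fun x : ComposableArrows J Δ.len => F.obj (op (x.obj 0)))
          (y.whiskerLeft φ.toOrderHom.monotone.functor) ≫ ·) (α.naturality _) }
  map_id F := by
    ext Δ
    refine Pi.hom_ext _ _ fun y => (roosObjMap_π (𝟙 F) _ y).trans ?_
    exact (Category.comp_id _).trans (Category.id_comp _).symm
  map_comp α β := by
    ext Δ
    refine Pi.hom_ext _ _ fun y => (roosObjMap_π (α ≫ β) _ y).trans ?_
    change _ = (roosObjMap α Δ.len ≫ roosObjMap β Δ.len) ≫ _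
    rw [Category.assoc, roosObjMap_π, ← Category.assoc, roosObjMap_π, Category.assoc]
    rfl

/-- The Roos complex: the cochain complex with `n`-th object `∏ F(i₀)`, whose differential is the
alternating sum of the coface maps. -/
noncomputable def roosComplex : (Jᵒᵖ ⥤ A) ⥤ CochainComplex A ℕ :=
  roosCosimplicial J A ⋙ AlgebraicTopology.alternatingCofaceMapComplex A

instance : (roosComplex J A).Additive where
  map_add {F G α β} := by
    ext n
    refine Pi.hom_ext _ _ fun y => (roosObjMap_π (α + β) n y).trans ?_
    change _ = (roosObjMap α n + roosObjMap β n) ≫ _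
    rw [Preadditive.add_comp, roosObjMap_π, roosObjMap_π, ← Preadditive.comp_add]
    rfl

/-- The `n`-th cohomology of the Roos complex. -/
noncomputable def roosCohomology (n : ℕ) : (Jᵒᵖ ⥤ A) ⥤ A :=
  roosComplex J A ⋙ HomologicalComplex.homologyFunctor A (ComplexShape.up ℕ) n

instance (n : ℕ) : (roosCohomology J A n).Additive := by
  unfold roosCohomology
  infer_instance

end Roos

instance additive_lim (K : Type u') [Category.{v'} K] (A : Type u) [Category.{v} A] [Abelian A]
    [HasLimitsOfShape K A] : (lim : (K ⥤ A) ⥤ A).Additive where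
  map_add := by
    intro F G α β
    refine limit.hom_ext fun j => ?_
    simp [Preadditive.add_comp, Preadditive.comp_add]

/-! ### Grothendieck's criterion: effaceable `δ`-functors are universal -/

section DeltaFunctors

variable {C : Type u} [Category.{v} C] [Abelian C] {D : Type u'} [Category.{v'} D] [Abelian D]

/-! A `δ`-functor that is effaceable in positive degrees is universal (`DeltaFunctor.isUniversal`),
so the theorem rests on three facts about the Roos complex.

Products of fewer than `κ` objects are exact, so a short exact sequence of functors gives a short
exact sequence of complexes, and the cohomology is a `δ`-functor. A 0-cocycle is a compatible family
in `∏ F(i)`, so `T⁰ = lim` (`roosCohomologyZeroIso`). For effaceability, embed `F` by its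
restriction maps in `M(j) = ∏_{k → j} F(k)`, the functor coinduced from the discrete category on the
objects. Prolonging a simplex `i₀ → ⋯ → iₙ` by an arrow `k → i₀` defines `h : Nₙ₊₁(F) → Nₙ(M)`, and
`h` is a null homotopy of `N(F) → N(M)` in positive degrees (`roosComplex_map_cofreeUnit`).

Uniqueness of derived functors is then formal. For an injective resolution `I` of `X` with cocycles
`Z`, dimension shifting shows that `Tⁿ⁺¹(X)` is the cokernel of `T⁰(Iⁿ) → T⁰(Zⁿ⁺¹)`. Since `T⁰` is
left exact, the cohomology of `T⁰(I)` in degree `n + 1` is the same cokernel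
(`DeltaFunctor.nonempty_rightDerived_iso`). -/

theorem shortExact_cokernel {X M : C} (m : X ⟶ M) [Mono m] :
    (ShortComplex.mk m (cokernel.π m) (cokernel.condition m)).ShortExact where
  exact := ShortComplex.exact_cokernel m
  mono_f := ‹_›
  epi_g := inferInstanceAs (Epi (cokernel.π m))

/-- A commutative square between the first maps of two short complexes extends to a morphism of
short complexes if the source is short exact. -/
noncomputable def CategoryTheory.ShortComplex.ShortExact.homMk {S S' : ShortComplex C}
    (hS : S.ShortExact) (τ₁ : S.X₁ ⟶ S'.X₁) (τ₂ : S.X₂ ⟶ S'.X₂)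
    (comm : τ₁ ≫ S'.f = S.f ≫ τ₂) : S ⟶ S' :=
  haveI := hS.epi_g
  { τ₁ := τ₁
    τ₂ := τ₂
    τ₃ := hS.exact.desc (τ₂ ≫ S'.g) (by rw [← Category.assoc, ← comm, Category.assoc, S'.zero,
      comp_zero])
    comm₁₂ := comm
    comm₂₃ := (hS.exact.g_desc _ _).symm }

variable {T : ℕ → C ⥤ D} [∀ n, (T n).Additive] {U : ℕ → C ⥤ D} [∀ n, (U n).Additive]

theorem DeltaFunctor.epi_δ (P : DeltaFunctor T) (n : ℕ) {S : ShortComplex C} (hS : S.ShortExact)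
    (h : (T (n + 1)).map S.f = 0) : Epi (P.δ n hS) :=
  (P.exact₁ n hS).epi_f h

/-- If `T (n + 1)` kills `S.f`, then `P.δ n hS` is a cokernel of `(T n).map S.g`, and `φ` followed
by the connecting morphism of `Q` kills `(T n).map S.g` because `Q` is a complex. -/
theorem DeltaFunctor.exists_desc (P : DeltaFunctor T) (Q : ConnectedSequence U) (n : ℕ)
    (φ : T n ⟶ U n) {S : ShortComplex C} (hS : S.ShortExact) (h : (T (n + 1)).map S.f = 0) :
    ∃ a : (T (n + 1)).obj S.X₁ ⟶ (U (n + 1)).obj S.X₁,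
      P.δ n hS ≫ a = φ.app S.X₃ ≫ Q.δ n hS := by
  have := P.epi_δ n hS h
  refine ⟨(P.exact₃ n hS).desc (φ.app S.X₃ ≫ Q.δ n hS) ?_, (P.exact₃ n hS).g_desc _ _⟩
  exact (φ.naturality_assoc S.g _).trans (by rw [Q.comp_δ, comp_zero])

theorem ConnectedSequence.comp_desc_of_hom (P : ConnectedSequence T) (Q : ConnectedSequence U)
    (n : ℕ) (φ : T n ⟶ U n) {S S' : ShortComplex C} (hS : S.ShortExact) (hS' : S'.ShortExact)
    (f : S ⟶ S') (a' : (T (n + 1)).obj S'.X₁ ⟶ (U (n + 1)).obj S'.X₁)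
    (ha' : P.δ n hS' ≫ a' = φ.app S'.X₃ ≫ Q.δ n hS') :
    P.δ n hS ≫ (T (n + 1)).map f.τ₁ ≫ a' =
      φ.app S.X₃ ≫ Q.δ n hS ≫ (U (n + 1)).map f.τ₁ := by
  rw [← Category.assoc, ← P.δ_naturality n hS hS' f, Category.assoc, ha',
    ← Q.δ_naturality n hS hS' f, φ.naturality_assoc]

/-- The map `f` need not extend to a morphism of short exact sequences, since `S'.X₂` is not assumed
injective. Both sequences do map to the one given by `S'.X₁ ⟶ pushout S.f (f ≫ S'.f)`: `S'` over the
identity, `S` over `f`. The first of these morphisms shows that the pushout sequence induces the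
same map `a'`, the second then gives the claim. -/
theorem DeltaFunctor.comp_desc (P : DeltaFunctor T) (Q : ConnectedSequence U)
    (n : ℕ) (φ : T n ⟶ U n) {S S' : ShortComplex C} (hS : S.ShortExact) (hS' : S'.ShortExact)
    (h : (T (n + 1)).map S'.f = 0) (f : S.X₁ ⟶ S'.X₁)
    (a' : (T (n + 1)).obj S'.X₁ ⟶ (U (n + 1)).obj S'.X₁)
    (ha' : P.δ n hS' ≫ a' = φ.app S'.X₃ ≫ Q.δ n hS') :
    P.δ n hS ≫ (T (n + 1)).map f ≫ a' = φ.app S.X₃ ≫ Q.δ n hS ≫ (U (n + 1)).map f := by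
  have := hS.mono_f
  have := hS'.mono_f
  let i : S'.X₁ ⟶ pushout S.f (f ≫ S'.f) := S'.f ≫ pushout.inr S.f (f ≫ S'.f)
  -- `pushout.inr` is a pushout of the monomorphism `S.f`, hence a monomorphism. Since `i` factors
  -- through `S'.f`, it is also killed by `T (n + 1)`.
  have : Mono i := mono_comp _ _
  have hN := shortExact_cokernel i
  obtain ⟨b, hb⟩ := P.exists_desc Q n φ hN (by
    change (T (n + 1)).map (S'.f ≫ _) = 0
    rw [Functor.map_comp, h, zero_comp])
  have hab : a' = b := by
    have := P.epi_δ n hS' h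
    have key := P.comp_desc_of_hom Q n φ hS' hN
      (hS'.homMk (𝟙 S'.X₁) (pushout.inr S.f (f ≫ S'.f)) (Category.id_comp _)) b hb
    rw [← cancel_epi (P.δ n hS'), ha']
    change _ ≫ (T (n + 1)).map (𝟙 _) ≫ _ = _ ≫ _ ≫ (U (n + 1)).map (𝟙 _) at key
    rw [(T (n + 1)).map_id, (U (n + 1)).map_id, Category.id_comp, Category.comp_id] at key
    exact key.symm
  subst hab
  exact P.comp_desc_of_hom Q n φ hS hN (hS.homMk f (pushout.inl S.f (f ≫ S'.f))
    ((Category.assoc _ _ _).symm.trans pushout.condition.symm)) a' hb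

/-- Each component comes from a chosen effacement of `X`. Naturality is `comp_desc` for two chosen
effacements; compatibility with an arbitrary short exact sequence is `comp_desc` for the identity of
its first term, so the choices do not matter. -/
theorem DeltaFunctor.exists_extension (P : DeltaFunctor T) (Q : ConnectedSequence U) (n : ℕ)
    (hT : IsEffaceable (T (n + 1))) (φ : T n ⟶ U n) :
    ∃ ψ : T (n + 1) ⟶ U (n + 1), ∀ (S : ShortComplex C) (hS : S.ShortExact),
      P.δ n hS ≫ ψ.app S.X₁ = φ.app S.X₃ ≫ Q.δ n hS := by
  choose M m hm h₀ using hT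
  have hm' : ∀ X, (ShortComplex.mk (m X) (cokernel.π (m X)) (cokernel.condition _)).ShortExact :=
    fun X => have := hm X; shortExact_cokernel (m X)
  choose a ha using fun X => P.exists_desc Q n φ (hm' X) (h₀ X)
  refine ⟨{ app := a, naturality := fun X Y f => ?_ }, fun S hS => ?_⟩
  · have := P.epi_δ n (hm' X) (h₀ X)
    rw [← cancel_epi (P.δ n (hm' X))]
    refine (P.comp_desc Q n φ (hm' X) (hm' Y) (h₀ Y) f (a Y) (ha Y)).trans ?_
    rw [← Category.assoc, ← ha X, Category.assoc]
  · have key := P.comp_desc Q n φ hS (hm' S.X₁) (h₀ S.X₁) (𝟙 S.X₁) (a S.X₁) (ha S.X₁)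
    rw [(T (n + 1)).map_id, (U (n + 1)).map_id, Category.comp_id] at key
    exact (congrArg _ (Category.id_comp _).symm).trans key

/-- A `δ`-functor which is effaceable in positive degrees is universal. -/
theorem DeltaFunctor.isUniversal (P : DeltaFunctor T) (hT : ∀ n, IsEffaceable (T (n + 1))) :
    P.toConnectedSequence.IsUniversal := by
  intro U _ Q φ₀
  choose ext h_ext using fun n => P.exists_extension Q n (hT n)
  refine ⟨fun n => Nat.rec φ₀ ext n, ⟨rfl, fun n S hS => h_ext n _ S hS⟩, ?_⟩
  rintro φ ⟨h₀, hφ⟩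
  funext n
  induction n with
  | zero => exact h₀
  | succ n ih =>
    -- On an effacement of `X` the connecting morphism is epi, so the component in degree `n + 1` is
    -- determined by degree `n`.
    ext X
    obtain ⟨M, m, hm, h⟩ := hT n X
    have hS := shortExact_cokernel m
    have := P.epi_δ n hS h
    rw [← cancel_epi (P.δ n hS)]
    exact (hφ n _ hS).trans ((congrArg (fun ψ : T n ⟶ U n => ψ.app _ ≫ Q.δ n hS) ih).trans
      (h_ext n _ _ hS).symm)

namespace ConnectedSequence

variable {V : ℕ → C ⥤ D} [∀ n, (V n).Additive] {P : ConnectedSequence T}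
  {Q : ConnectedSequence U} {R : ConnectedSequence V}

theorem isMorphism_id (P : ConnectedSequence T) : P.IsMorphism P (fun n => 𝟙 (T n)) := by
  intro n S hS
  simp

theorem IsMorphism.comp {φ : ∀ n, T n ⟶ U n} {ψ : ∀ n, U n ⟶ V n} (hφ : P.IsMorphism Q φ)
    (hψ : Q.IsMorphism R ψ) : P.IsMorphism R (fun n => φ n ≫ ψ n) := by
  intro n S hS
  rw [NatTrans.comp_app, NatTrans.comp_app, ← Category.assoc, hφ n S hS, Category.assoc,
    hψ n S hS, Category.assoc]

/-- An isomorphism between the degree zero functors of universal connected sequences extends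
uniquely to an isomorphism of connected sequences. -/
theorem IsUniversal.existsUnique_iso (hP : P.IsUniversal) (hQ : Q.IsUniversal) (e₀ : T 0 ≅ U 0) :
    ∃! e : ∀ n, T n ≅ U n, e 0 = e₀ ∧ P.IsMorphism Q (fun n => (e n).hom) := by
  obtain ⟨φ, ⟨hφ₀, hφ⟩, hφ'⟩ := hP U Q e₀.hom
  obtain ⟨ψ, ⟨hψ₀, hψ⟩, -⟩ := hQ T P e₀.inv
  have h₁ : (fun n => φ n ≫ ψ n) = fun n => 𝟙 (T n) :=
    (hP T P (𝟙 (T 0))).unique ⟨by rw [hφ₀, hψ₀, Iso.hom_inv_id], hφ.comp hψ⟩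
      ⟨rfl, P.isMorphism_id⟩
  have h₂ : (fun n => ψ n ≫ φ n) = fun n => 𝟙 (U n) :=
    (hQ U Q (𝟙 (U 0))).unique ⟨by rw [hφ₀, hψ₀, Iso.inv_hom_id], hψ.comp hφ⟩
      ⟨rfl, Q.isMorphism_id⟩
  refine ⟨fun n => ⟨φ n, ψ n, congrFun h₁ n, congrFun h₂ n⟩, ⟨Iso.ext hφ₀, hφ⟩, ?_⟩
  rintro e ⟨he₀, he⟩
  funext n
  exact Iso.ext (congrFun (hφ' (fun n => (e n).hom) ⟨congrArg Iso.hom he₀, he⟩) n)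

end ConnectedSequence

theorem RightDerivedFunctors.existsUnique_iso {F : C ⥤ D} (R : RightDerivedFunctors F T)
    (R' : RightDerivedFunctors F U) :
    ∃! e : ∀ n, T n ≅ U n, (e 0).hom ≫ R'.iso₀.hom = R.iso₀.hom ∧
      R.toConnectedSequence.IsMorphism R'.toConnectedSequence (fun n => (e n).hom) := by
  have h : ∀ e : T 0 ≅ U 0, e = R.iso₀ ≪≫ R'.iso₀.symm ↔ e.hom ≫ R'.iso₀.hom = R.iso₀.hom := by
    refine fun e => ⟨?_, fun h => Iso.ext ?_⟩
    · rintro rfl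
      simp
    · simp [← h]
  simpa only [h] using R.universal.existsUnique_iso R'.universal (R.iso₀ ≪≫ R'.iso₀.symm)

end DeltaFunctors

/-! ### The Roos complex: exactness in `F`, and degree zero -/

section Roos

variable {J : Type w} [SmallCategory J] {A : Type u} [Category.{v} A] [Abelian A]

theorem SatisfiesAB4Star.shortExact_prod {κ : Cardinal.{w}} (hA : SatisfiesAB4Star κ A) {ι : Type w}
    (hι : HasCardinalLT ι κ) [HasProductsOfShape ι A] {X Y Z : ι → A} (f : ∀ i, X i ⟶ Y i)
    (g : ∀ i, Y i ⟶ Z i) (w : ∀ i, f i ≫ g i = 0)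
    (h : ∀ i, (ShortComplex.mk (f i) (g i) (w i)).ShortExact)
    (w' : Limits.Pi.map f ≫ Limits.Pi.map g = 0) :
    (ShortComplex.mk (Limits.Pi.map f) (Limits.Pi.map g) w').ShortExact where
  exact := hA.exact_prod ι hι _ fun i => (h i).exact
  mono_f := by
    have := fun i => (h i).mono_f
    dsimp at this ⊢
    infer_instance
  epi_g := by
    -- Surjectivity is exactness of `Y i ⟶ Z i ⟶ 0`, so the hypothesis on products is applied to the
    -- zero maps `Z i ⟶ Z i`.
    refine ((ShortComplex.exact_iff_epi (ShortComplex.mk (Limits.Pi.map g)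
      (Limits.Pi.map fun i => (0 : Z i ⟶ Z i)) (by ext; simp)) (by ext; simp)).1
      (hA.exact_prod ι hι (fun i => ShortComplex.mk (g i) (0 : Z i ⟶ Z i) comp_zero) fun i => ?_))
    exact (ShortComplex.exact_iff_epi _ rfl).2 (h i).epi_g

variable [∀ n, HasProductsOfShape (ComposableArrows J n) A]

theorem SatisfiesAB4Star.shortExact_map_roosComplex {κ : Cardinal.{w}}
    (hA : SatisfiesAB4Star κ A) (hκ : Cardinal.aleph0 ≤ κ) (hJ : HasCardinalLT (Arrow J) κ)
    {S : ShortComplex (Jᵒᵖ ⥤ A)} (hS : S.ShortExact) :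
    (S.map (roosComplex J A)).ShortExact := by
  refine HomologicalComplex.shortExact_of_degreewise_shortExact _ fun n => ?_
  exact hA.shortExact_prod (hasCardinalLT_composableArrows hκ hJ n)
    (fun x => S.f.app (op (x.obj 0))) (fun x => S.g.app (op (x.obj 0)))
    (fun x => (S.map ((evaluation Jᵒᵖ A).obj (op (x.obj 0)))).zero)
    (fun x => hS.map_of_exact ((evaluation Jᵒᵖ A).obj (op (x.obj 0))))
    ((S.map (roosComplex J A)).map (HomologicalComplex.eval A _ n)).zero

/-- The projection from the product of the `F(i₀)` to one of its factors. -/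
noncomputable def roosπ (F : Jᵒᵖ ⥤ A) {n : ℕ} (x : ComposableArrows J n) :
    ((roosComplex J A).obj F).X n ⟶ F.obj (op (x.obj 0)) :=
  Pi.π (fun x : ComposableArrows J n => F.obj (op (x.obj 0))) x

/-- The morphism to the product of the `F(i₀)` with given components. -/
noncomputable def roosLift (F : Jᵒᵖ ⥤ A) {n : ℕ} {W : A}
    (f : ∀ x : ComposableArrows J n, W ⟶ F.obj (op (x.obj 0))) :
    W ⟶ ((roosComplex J A).obj F).X n :=
  Pi.lift f

/-- The coface maps of the Roos complex. -/
noncomputable def roosδ (F : Jᵒᵖ ⥤ A) {n : ℕ} (i : Fin (n + 2)) :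
    ((roosComplex J A).obj F).X n ⟶ ((roosComplex J A).obj F).X (n + 1) :=
  (roosCosimplicialObj F).δ i

theorem roos_hom_ext {F : Jᵒᵖ ⥤ A} {n : ℕ} {W : A} {f g : W ⟶ ((roosComplex J A).obj F).X n}
    (h : ∀ x : ComposableArrows J n, f ≫ roosπ F x = g ≫ roosπ F x) : f = g :=
  Pi.hom_ext _ _ h

theorem roosLift_π (F : Jᵒᵖ ⥤ A) {n : ℕ} {W : A}
    (f : ∀ x : ComposableArrows J n, W ⟶ F.obj (op (x.obj 0))) (x : ComposableArrows J n) :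
    roosLift F f ≫ roosπ F x = f x :=
  Pi.lift_π _ _

theorem roosComplex_map_f_π {F G : Jᵒᵖ ⥤ A} (α : F ⟶ G) {n : ℕ} (x : ComposableArrows J n) :
    ((roosComplex J A).map α).f n ≫ roosπ G x = roosπ F x ≫ α.app (op (x.obj 0)) :=
  roosObjMap_π α n x

/-- Equal simplices have initial vertices that are only propositionally equal; the `eqToHom` carries
this transport. -/
theorem roosπ_comp_map_eq (F : Jᵒᵖ ⥤ A) {n : ℕ} {x x' : ComposableArrows J n} (h : x = x') {k : J}
    (f : k ⟶ x.obj 0) (f' : k ⟶ x'.obj 0)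
    (hf : f ≫ eqToHom (by rw [h]) = f') :
    roosπ F x ≫ F.map f.op = roosπ F x' ≫ F.map f'.op := by
  subst h hf
  simp

theorem roosComplex_d (F : Jᵒᵖ ⥤ A) (n : ℕ) : ((roosComplex J A).obj F).d n (n + 1) =
    ∑ i : Fin (n + 2), (-1 : ℤ) ^ (i : ℕ) • roosδ F i :=
  CochainComplex.of_d (fun n => (roosCosimplicialObj F).obj (SimplexCategory.mk n))
    (AlgebraicTopology.AlternatingCofaceMapComplex.objD (roosCosimplicialObj F)) n

theorem roosδ_π (F : Jᵒᵖ ⥤ A) {n : ℕ} (i : Fin (n + 2)) (y : ComposableArrows J (n + 1)) :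
    roosδ F i ≫ roosπ F y =
      roosπ F (y.whiskerLeft (SimplexCategory.δ i).toOrderHom.monotone.functor) ≫
        F.map (y.map (homOfLE (Fin.zero_le ((SimplexCategory.δ i).toOrderHom 0)))).op :=
  Pi.lift_π _ _

/-- The projection to the factor of index `j` in degree zero. -/
noncomputable def roosπ₀ (F : Jᵒᵖ ⥤ A) (j : J) : ((roosComplex J A).obj F).X 0 ⟶ F.obj (op j) :=
  roosπ F (ComposableArrows.mk₀ j)

/-- The projection to the factor of index `f : i ⟶ j` in degree one. -/
noncomputable def roosπ₁ (F : Jᵒᵖ ⥤ A) {i j : J} (f : i ⟶ j) :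
    ((roosComplex J A).obj F).X 1 ⟶ F.obj (op i) :=
  roosπ F (ComposableArrows.mk₁ f)

theorem roos_hom_ext₀ {F : Jᵒᵖ ⥤ A} {W : A} {f g : W ⟶ ((roosComplex J A).obj F).X 0}
    (h : ∀ j : J, f ≫ roosπ₀ F j = g ≫ roosπ₀ F j) : f = g :=
  roos_hom_ext fun x => by
    obtain ⟨j, rfl⟩ := ComposableArrows.mk₀_surjective x
    exact h j

theorem roos_hom_ext₁ {F : Jᵒᵖ ⥤ A} {W : A} {f g : W ⟶ ((roosComplex J A).obj F).X 1}
    (h : ∀ {i j : J} (a : i ⟶ j), f ≫ roosπ₁ F a = g ≫ roosπ₁ F a) : f = g :=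
  roos_hom_ext fun x => by
    obtain ⟨i, j, a, rfl⟩ := ComposableArrows.mk₁_surjective x
    exact h a

/-- Face `0` of `i ⟶ j` is `j` and brings in `F.map f.op`; face `1` is `i`, with structure map the
identity. A 0-cocycle is therefore exactly a compatible family. -/
theorem roosComplex_d_zero_π (F : Jᵒᵖ ⥤ A) {i j : J} (f : i ⟶ j) :
    ((roosComplex J A).obj F).d 0 1 ≫ roosπ₁ F f = roosπ₀ F j ≫ F.map f.op - roosπ₀ F i := by
  rw [roosComplex_d, Fin.sum_univ_two]
  simp only [Fin.val_zero, Fin.val_one, pow_zero, pow_one, one_smul, neg_smul,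
    ← sub_eq_add_neg, Preadditive.sub_comp]
  congr 1
  · refine (roosδ_π F _ (ComposableArrows.mk₁ f)).trans ?_
    refine roosπ_comp_map_eq F (x' := ComposableArrows.mk₀ j) ?_ _ f ?_
    · exact ComposableArrows.ext₀ rfl
    · exact Category.comp_id _
  · refine (roosδ_π F _ (ComposableArrows.mk₁ f)).trans ?_
    refine (roosπ_comp_map_eq F (x' := ComposableArrows.mk₀ i) ?_ _ (𝟙 i) ?_).trans ?_
    · exact ComposableArrows.ext₀ rfl
    · exact Category.comp_id _
    · exact (congrArg (roosπ₀ F i ≫ ·) (F.map_id _)).trans (Category.comp_id _)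

/-- The compatible families in the product of all `F(i)` are the zero cocycles of the Roos
complex. -/
noncomputable def limitIsoRoosCycles [HasLimitsOfShape Jᵒᵖ A] (F : Jᵒᵖ ⥤ A) :
    limit F ≅ ((roosComplex J A).obj F).cycles 0 where
  hom := ((roosComplex J A).obj F).liftCycles
    (roosLift F fun x : ComposableArrows J 0 => limit.π F (op (x.obj 0))) 1 (by simp) (by
      refine roos_hom_ext₁ fun {i j} f => ?_
      have h : ∀ j, (roosLift F fun x : ComposableArrows J 0 => limit.π F (op (x.obj 0))) ≫
        roosπ₀ F j = limit.π F (op j) := fun j => roosLift_π _ _ _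
      rw [zero_comp, Category.assoc, roosComplex_d_zero_π, Preadditive.comp_sub, h,
        ← Category.assoc, h, limit.w, sub_self])
  inv := limit.lift F
    { pt := ((roosComplex J A).obj F).cycles 0
      π :=
        { app := fun j => ((roosComplex J A).obj F).iCycles 0 ≫ roosπ₀ F j.unop
          naturality := fun i j f => by
            -- The component of the cocycle identity at the arrow `f.unop` is the naturality of the
            -- cone at `f`.
            have h := ((roosComplex J A).obj F).iCycles_d 0 1 =≫ roosπ₁ F f.unop
            rw [Category.assoc, roosComplex_d_zero_π, zero_comp, Preadditive.comp_sub,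
              sub_eq_zero] at h
            exact (Category.id_comp _).trans (h.symm.trans (Category.assoc _ _ _).symm) } }
  hom_inv_id := by
    refine limit.hom_ext fun j => ?_
    rw [Category.assoc, limit.lift_π, Category.id_comp]
    dsimp only
    rw [HomologicalComplex.liftCycles_i_assoc]
    exact roosLift_π _ _ _
  inv_hom_id := by
    rw [← cancel_mono (((roosComplex J A).obj F).iCycles 0), Category.assoc,
      HomologicalComplex.liftCycles_i, Category.id_comp]
    refine roos_hom_ext₀ fun j => ?_
    rw [Category.assoc]
    exact (congrArg _ (roosLift_π _ _ _)).trans (limit.lift_π _ _)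

theorem limitIsoRoosCycles_hom_iCycles [HasLimitsOfShape Jᵒᵖ A] (F : Jᵒᵖ ⥤ A) :
    (limitIsoRoosCycles F).hom ≫ ((roosComplex J A).obj F).iCycles 0 =
      roosLift F fun x : ComposableArrows J 0 => limit.π F (op (x.obj 0)) := by
  dsimp only [limitIsoRoosCycles]
  rw [HomologicalComplex.liftCycles_i]

theorem limitIsoRoosCycles_hom_naturality [HasLimitsOfShape Jᵒᵖ A] {F G : Jᵒᵖ ⥤ A} (α : F ⟶ G) :
    lim.map α ≫ (limitIsoRoosCycles G).hom =
      (limitIsoRoosCycles F).hom ≫ HomologicalComplex.cyclesMap ((roosComplex J A).map α) 0 := by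
  rw [← cancel_mono (((roosComplex J A).obj G).iCycles 0), Category.assoc, Category.assoc,
    HomologicalComplex.cyclesMap_i, limitIsoRoosCycles_hom_iCycles,
    reassoc_of% limitIsoRoosCycles_hom_iCycles]
  refine roos_hom_ext fun x => ?_
  rw [Category.assoc, Category.assoc, roosLift_π, roosComplex_map_f_π, reassoc_of% roosLift_π]
  exact limMap_π α _

/-- The cohomology of the Roos complex in degree zero is the limit. -/
noncomputable def roosCohomologyZeroIso [HasLimitsOfShape Jᵒᵖ A] :
    roosCohomology J A 0 ≅ (lim : (Jᵒᵖ ⥤ A) ⥤ A) :=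
  (NatIso.ofComponents (F := lim) (G := roosComplex J A ⋙ HomologicalComplex.homologyFunctor A _ 0)
    (fun F => limitIsoRoosCycles F ≪≫ CochainComplex.isoHomologyπ₀ ((roosComplex J A).obj F))
    (fun {F G} α => by
      refine (Category.assoc _ _ _).symm.trans ?_
      refine (congrArg (· ≫ _) (limitIsoRoosCycles_hom_naturality α)).trans ?_
      refine (Category.assoc _ _ _).trans (Eq.trans ?_ (Category.assoc _ _ _).symm)
      exact congrArg _ (HomologicalComplex.homologyπ_naturality _ _).symm)).symm

/-- The functor `lim` preserves limits, in particular pullbacks, hence monomorphisms; this passes to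
the isomorphic functor in degree zero. -/
theorem CategoryTheory.ShortComplex.ShortExact.mono_roosCohomology_zero_map_f
    [HasLimitsOfShape Jᵒᵖ A] {S : ShortComplex (Jᵒᵖ ⥤ A)} (hS : S.ShortExact) :
    Mono ((roosCohomology J A 0).map S.f) := by
  have := hS.mono_f
  have := preservesLimitsOfShape_of_natIso (J := WalkingCospan)
    (roosCohomologyZeroIso (J := J) (A := A)).symm
  infer_instance

/-- The `δ`-functor structure on the cohomology of the Roos complex which is given by the long exact
cohomology sequences. -/
noncomputable def roosDeltaFunctor
    [HasLimitsOfShape Jᵒᵖ A]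
    (hN : ∀ {S : ShortComplex (Jᵒᵖ ⥤ A)}, S.ShortExact → (S.map (roosComplex J A)).ShortExact) :
    DeltaFunctor (roosCohomology J A) where
  δ n _ hS := (hN hS).δ n (n + 1) rfl
  comp_δ n _ hS := (hN hS).comp_δ n (n + 1) rfl
  δ_comp n _ hS := (hN hS).δ_comp n (n + 1) rfl
  δ_naturality n _ _ hS hS' h :=
    (HomologicalComplex.HomologySequence.δ_naturality
      ((roosComplex J A).mapShortComplex.map h) (hN hS) (hN hS') n (n + 1) rfl).symm
  mono_map_f hS := hS.mono_roosCohomology_zero_map_f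
  exact₂ n _ hS := (hN hS).homology_exact₂ n
  exact₃ n _ hS := (hN hS).homology_exact₃ n (n + 1) rfl
  exact₁ n _ hS := (hN hS).homology_exact₁ n (n + 1) rfl

end Roos

/-! ### Effaceability of the Roos cohomology in positive degrees -/

section Effaceable

variable {J : Type w} [SmallCategory J] {A : Type u} [Category.{v} A] [Abelian A]

/-- On cocycles the term through `K.d` vanishes and the other is a coboundary. The homotopy relation
is needed in degree `j` only, which matters because the one for the Roos complex fails to exist in
degree zero. -/
theorem HomologicalComplex.homologyMap_eq_zero_of_eq_add {K L : CochainComplex A ℕ} (φ : K ⟶ L)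
    (i j k : ℕ) (h : K.X j ⟶ L.X i) (h' : K.X k ⟶ L.X j)
    (hφ : φ.f j = K.d j k ≫ h' + h ≫ L.d i j) :
    HomologicalComplex.homologyMap φ j = 0 := by
  have hc : HomologicalComplex.cyclesMap φ j = (K.iCycles j ≫ h) ≫ L.toCycles i j := by
    rw [← cancel_mono (L.iCycles j), HomologicalComplex.cyclesMap_i, hφ, Category.assoc,
      HomologicalComplex.toCycles_i, Preadditive.comp_add, HomologicalComplex.iCycles_d_assoc,
      zero_comp, zero_add, Category.assoc]
  rw [← cancel_epi (K.homologyπ j), HomologicalComplex.homologyπ_naturality, hc, Category.assoc,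
    HomologicalComplex.toCycles_comp_homologyπ, comp_zero, comp_zero]

section Cofree

variable [∀ j : J, HasProductsOfShape (Σ k : J, k ⟶ j) A]

/-- The functor which sends `j` to the product of the `F(k)` over all the morphisms `k ⟶ j`. -/
noncomputable def cofreeOnObj (F : Jᵒᵖ ⥤ A) : Jᵒᵖ ⥤ A where
  obj j := ∏ᶜ fun p : Σ k : J, k ⟶ j.unop => F.obj (op p.1)
  map {i j} g := Pi.lift fun p : Σ k : J, k ⟶ j.unop =>
    Pi.π (fun p : Σ k : J, k ⟶ i.unop => F.obj (op p.1)) ⟨p.1, p.2 ≫ g.unop⟩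
  map_id j := by
    refine Pi.hom_ext _ _ fun p => ?_
    rw [Pi.lift_π, Category.id_comp, unop_id, Category.comp_id]
  map_comp f g := by
    refine Pi.hom_ext _ _ fun p => ?_
    rw [Pi.lift_π, Category.assoc, Pi.lift_π, Pi.lift_π, unop_comp, Category.assoc]

/-- The projection of the product of the `F(k)` to the factor of index `f : k ⟶ j`. -/
noncomputable def cofreeπ (F : Jᵒᵖ ⥤ A) {k j : J} (f : k ⟶ j) :
    (cofreeOnObj F).obj (op j) ⟶ F.obj (op k) :=
  Pi.π (fun p : Σ k : J, k ⟶ j => F.obj (op p.1)) ⟨k, f⟩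

omit [Abelian A] in
theorem cofree_hom_ext {F : Jᵒᵖ ⥤ A} {j : J} {W : A} {f g : W ⟶ (cofreeOnObj F).obj (op j)}
    (h : ∀ {k : J} (a : k ⟶ j), f ≫ cofreeπ F a = g ≫ cofreeπ F a) : f = g :=
  Pi.hom_ext _ _ fun p => h p.2

/-- The morphism to the product of the `F(k)` with given components. -/
noncomputable def cofreeLift (F : Jᵒᵖ ⥤ A) {j : J} {W : A}
    (f : ∀ {k : J} (_ : k ⟶ j), W ⟶ F.obj (op k)) : W ⟶ (cofreeOnObj F).obj (op j) :=
  Pi.lift fun p => f p.2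

omit [Abelian A] in
theorem cofreeLift_π (F : Jᵒᵖ ⥤ A) {j : J} {W : A}
    (f : ∀ {k : J} (_ : k ⟶ j), W ⟶ F.obj (op k)) {k : J} (a : k ⟶ j) :
    cofreeLift F f ≫ cofreeπ F a = f a :=
  Pi.lift_π _ _

omit [Abelian A] in
theorem cofree_map_π (F : Jᵒᵖ ⥤ A) {i j k : J} (g : i ⟶ j) (f : k ⟶ i) :
    (cofreeOnObj F).map g.op ≫ cofreeπ F f = cofreeπ F (f ≫ g) :=
  Pi.lift_π _ _

/-- The embedding of `F` into `cofreeOnObj F`. -/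
noncomputable def cofreeUnit (F : Jᵒᵖ ⥤ A) : F ⟶ cofreeOnObj F where
  app j := cofreeLift F (j := j.unop) fun f => F.map f.op
  naturality i j g := by
    refine cofree_hom_ext (j := j.unop) fun f => ?_
    rw [Category.assoc, cofreeLift_π, Category.assoc]
    refine Eq.trans ?_ (congrArg _ (cofree_map_π F g.unop f).symm)
    rw [cofreeLift_π, op_comp, F.map_comp]
    rfl

omit [Abelian A] in
theorem cofreeUnit_app_π (F : Jᵒᵖ ⥤ A) {j k : J} (f : k ⟶ j) :
    (cofreeUnit F).app (op j) ≫ cofreeπ F f = F.map f.op :=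
  cofreeLift_π F (fun f => F.map f.op) f

/-- Objectwise, the projection to the factor of index `𝟙 j` is a retraction. -/
instance (F : Jᵒᵖ ⥤ A) : Mono (cofreeUnit F) := by
  have (j : Jᵒᵖ) : Mono ((cofreeUnit F).app j) := by
    have h : (cofreeUnit F).app j ≫ cofreeπ F (𝟙 j.unop) = 𝟙 (F.obj j) :=
      (cofreeUnit_app_π F (𝟙 j.unop)).trans (F.map_id j)
    exact (SplitMono.mk _ h).mono
  exact NatTrans.mono_of_mono_app _

end Cofree

/-! ### Faces of a simplex prolonged at its initial vertex -/

section Precomp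

theorem precomp_whiskerLeft_δ_zero {n : ℕ} (y : ComposableArrows J n) {k : J} (f : k ⟶ y.obj 0) :
    (ComposableArrows.precomp y f).whiskerLeft
      (SimplexCategory.δ 0).toOrderHom.monotone.functor = y :=
  rfl

theorem precomp_map_zero_succ {n : ℕ} (y : ComposableArrows J n) {k : J} (f : k ⟶ y.obj 0)
    (a : Fin (n + 1)) :
    (ComposableArrows.precomp y f).map (homOfLE (Fin.zero_le a.succ)) =
      f ≫ y.map (homOfLE (Fin.zero_le a)) := by
  obtain ⟨_ | a, ha⟩ := a
  · exact ((congrArg (f ≫ ·) (y.map_id 0)).trans (Category.comp_id f)).symm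
  · rfl

/-- The extension of a monotone map by `0 ↦ 0`. -/
def Fin.succOrderHom {m n : ℕ} (φ : Fin (m + 1) →o Fin (n + 1)) :
    Fin (m + 2) →o Fin (n + 2) where
  toFun := Fin.cases 0 fun i => (φ i).succ
  monotone' a b h := by
    induction a using Fin.cases with
    | zero => exact Fin.zero_le _
    | succ a =>
      induction b using Fin.cases with
      | zero => exact absurd h (by simp)
      | succ b => exact Fin.succ_le_succ_iff.2 (φ.monotone (Fin.succ_le_succ_iff.1 h))

theorem precomp_whiskerLeft_succOrderHom {m n : ℕ} (y : ComposableArrows J n) {k : J}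
    (f : k ⟶ y.obj 0) (φ : Fin (m + 1) →o Fin (n + 1)) :
    (ComposableArrows.precomp y f).whiskerLeft (Fin.succOrderHom φ).monotone.functor =
    ComposableArrows.precomp (y.whiskerLeft φ.monotone.functor)
      (f ≫ y.map (homOfLE (Fin.zero_le (φ 0)))) := by
  refine ComposableArrows.ext_succ rfl rfl ?_
  exact (precomp_map_zero_succ y f (φ 0)).trans
    ((Category.id_comp _).trans (Category.comp_id _)).symm

theorem toOrderHom_δ_succ {n : ℕ} (i : Fin (n + 2)) :
    (SimplexCategory.δ i.succ).toOrderHom =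
      Fin.succOrderHom (SimplexCategory.δ i).toOrderHom := by
  ext a : 2
  induction a using Fin.cases with
  | zero => exact Fin.succ_succAbove_zero i
  | succ a => exact Fin.succ_succAbove_succ i a

theorem map_zero_comp_eqToHom {n : ℕ} (x : ComposableArrows J n) {a : Fin (n + 1)} (ha : a = 0)
    (h : x.obj a = x.obj 0) : x.map (homOfLE (Fin.zero_le a)) ≫ eqToHom h = 𝟙 _ := by
  subst ha
  exact (Category.comp_id _).trans (x.map_id 0)

/-- Face `i + 1` keeps the added vertex `k`, so it prolongs face `i` of `y`. The added arrow changes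
only for `i = 0`, where it absorbs the first arrow of `y`. -/
theorem precomp_whiskerLeft_δ_succ {n : ℕ} (y : ComposableArrows J (n + 1)) {k : J}
    (f : k ⟶ y.obj 0) (i : Fin (n + 2)) :
    (ComposableArrows.precomp y f).whiskerLeft
      (SimplexCategory.δ i.succ).toOrderHom.monotone.functor =
    ComposableArrows.precomp (y.whiskerLeft (SimplexCategory.δ i).toOrderHom.monotone.functor)
      (f ≫ y.map (homOfLE (Fin.zero_le ((SimplexCategory.δ i).toOrderHom 0)))) :=
  (congrArg (fun θ : Fin (n + 2) →o Fin (n + 3) =>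
    (ComposableArrows.precomp y f).whiskerLeft θ.monotone.functor) (toOrderHom_δ_succ i)).trans
      (precomp_whiskerLeft_succOrderHom y f _)

end Precomp

/-! ### The null homotopy -/

section Homotopy

variable [∀ n, HasProductsOfShape (ComposableArrows J n) A]

/-- The projection to the factor whose index is the simplex `y` extended by `f`. -/
noncomputable def roosπPrecomp (F : Jᵒᵖ ⥤ A) {n : ℕ} (y : ComposableArrows J n) {k : J}
    (f : k ⟶ y.obj 0) : ((roosComplex J A).obj F).X (n + 1) ⟶ F.obj (op k) :=
  roosπ F (ComposableArrows.precomp y f)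

theorem roosδ_zero_πPrecomp (F : Jᵒᵖ ⥤ A) {n : ℕ} (y : ComposableArrows J n) {k : J}
    (f : k ⟶ y.obj 0) : roosδ F 0 ≫ roosπPrecomp F y f = roosπ F y ≫ F.map f.op := by
  refine (roosδ_π F _ (ComposableArrows.precomp y f)).trans ?_
  refine roosπ_comp_map_eq F (x' := y) ?_ _ f ?_
  · exact precomp_whiskerLeft_δ_zero y f
  · exact Category.comp_id _

theorem roosδ_succ_πPrecomp (F : Jᵒᵖ ⥤ A) {n : ℕ} (y : ComposableArrows J (n + 1)) {k : J}
    (f : k ⟶ y.obj 0) (i : Fin (n + 2)) : roosδ F i.succ ≫ roosπPrecomp F y f =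
      roosπPrecomp F (y.whiskerLeft (SimplexCategory.δ i).toOrderHom.monotone.functor)
        (f ≫ y.map (homOfLE (Fin.zero_le ((SimplexCategory.δ i).toOrderHom 0)))) := by
  refine (roosδ_π F _ (ComposableArrows.precomp y f)).trans ?_
  refine (roosπ_comp_map_eq F (precomp_whiskerLeft_δ_succ y f i) _ (𝟙 k) ?_).trans ?_
  · exact map_zero_comp_eqToHom _ (Fin.succ_succAbove_zero i) _
  · exact (congrArg _ (F.map_id _)).trans (Category.comp_id _)

variable [∀ j : J, HasProductsOfShape (Σ k : J, k ⟶ j) A]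

/-- The null homotopy in positive degrees of the morphism of Roos complexes induced by
`cofreeUnit F`. -/
noncomputable def roosHomotopy (F : Jᵒᵖ ⥤ A) (n : ℕ) :
    ((roosComplex J A).obj F).X (n + 1) ⟶ ((roosComplex J A).obj (cofreeOnObj F)).X n :=
  roosLift _ fun y => cofreeLift F fun f => roosπPrecomp F y f

theorem roosHomotopy_π (F : Jᵒᵖ ⥤ A) {n : ℕ} (y : ComposableArrows J n) {k : J}
    (f : k ⟶ y.obj 0) :
    roosHomotopy F n ≫ roosπ (cofreeOnObj F) y ≫ cofreeπ F f = roosπPrecomp F y f := by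
  rw [roosHomotopy, reassoc_of% roosLift_π, cofreeLift_π]

/-- Face `0` removes the added vertex again and contributes `F.map f.op`, which is the component of
`cofreeUnit F` at `f`. -/
theorem roosδ_zero_homotopy (F : Jᵒᵖ ⥤ A) (n : ℕ) :
    roosδ F 0 ≫ roosHomotopy F n = ((roosComplex J A).map (cofreeUnit F)).f n := by
  refine roos_hom_ext fun y => cofree_hom_ext fun f => ?_
  rw [Category.assoc, Category.assoc, roosHomotopy_π, roosδ_zero_πPrecomp, roosComplex_map_f_π,
    Category.assoc, cofreeUnit_app_π]

/-- The remaining cofaces commute with the prolongation up to an index shift: the composite arrow in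
`precomp_whiskerLeft_δ_succ` is what the transition maps of `cofreeOnObj F` produce. -/
theorem roosδ_succ_homotopy (F : Jᵒᵖ ⥤ A) (n : ℕ) (i : Fin (n + 2)) :
    roosδ F i.succ ≫ roosHomotopy F (n + 1) = roosHomotopy F n ≫ roosδ (cofreeOnObj F) i := by
  refine roos_hom_ext fun y => cofree_hom_ext fun f => ?_
  have h : (roosδ (cofreeOnObj F) i ≫ roosπ (cofreeOnObj F) y) ≫ cofreeπ F f = _ :=
    (congrArg (· ≫ cofreeπ F f) (roosδ_π _ i y)).trans
      ((Category.assoc _ _ _).trans (congrArg _ (cofree_map_π F _ f)))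
  rw [Category.assoc, Category.assoc, roosHomotopy_π, Category.assoc, Category.assoc,
    ← Category.assoc (roosδ _ i), h]
  exact (roosδ_succ_πPrecomp F y f i).trans (roosHomotopy_π F _ _).symm

theorem roosComplex_map_cofreeUnit (F : Jᵒᵖ ⥤ A) (n : ℕ) :
    ((roosComplex J A).map (cofreeUnit F)).f (n + 1) =
      ((roosComplex J A).obj F).d (n + 1) (n + 2) ≫ roosHomotopy F (n + 1) +
        roosHomotopy F n ≫ ((roosComplex J A).obj (cofreeOnObj F)).d n (n + 1) := by
  -- The coface `0` summand is the map itself; coface `i + 1` on the left cancels coface `i` on the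
  -- right, the signs being opposite.
  rw [roosComplex_d, roosComplex_d, Fin.sum_univ_succ, Preadditive.add_comp,
    Preadditive.sum_comp, Preadditive.comp_sum, Fin.val_zero, pow_zero, one_smul,
    roosδ_zero_homotopy, add_assoc, ← Finset.sum_add_distrib, Finset.sum_eq_zero, add_zero]
  intro i _
  rw [Preadditive.zsmul_comp, Preadditive.comp_zsmul, roosδ_succ_homotopy, Fin.val_succ,
    pow_succ, mul_neg_one, neg_smul, neg_add_cancel]

theorem roosCohomology_map_cofreeUnit (F : Jᵒᵖ ⥤ A) (n : ℕ) :
    (roosCohomology J A (n + 1)).map (cofreeUnit F) = 0 :=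
  HomologicalComplex.homologyMap_eq_zero_of_eq_add _ n (n + 1) (n + 2) _ _
    (roosComplex_map_cofreeUnit F n)

theorem isEffaceable_roosCohomology (n : ℕ) : IsEffaceable (roosCohomology J A (n + 1)) :=
  fun F => ⟨cofreeOnObj F, cofreeUnit F, inferInstance, roosCohomology_map_cofreeUnit F n⟩

end Homotopy

theorem SatisfiesAB4Star.hasProductsOfShape_over {κ : Cardinal.{w}} (hA : SatisfiesAB4Star κ A)
    (hJ : HasCardinalLT (Arrow J) κ) (j : J) : HasProductsOfShape (Σ k : J, k ⟶ j) A :=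
  hA.hasProducts _ (hJ.of_injective (fun p => Arrow.mk p.2) (by
    rintro ⟨k, f⟩ ⟨k', f'⟩ h
    obtain rfl : k = k' := congrArg (fun f : Arrow J => f.left) h
    have h' : HEq (Arrow.mk f).hom (Arrow.mk f').hom := by
      rw [show Arrow.mk f = Arrow.mk f' from h]
    exact congrArg (Sigma.mk _) (eq_of_heq h')))

end Effaceable

/-! ### Comparison with injective resolutions -/

section InjectiveResolutions

variable {C : Type u} [Category.{v} C] [Abelian C] {D : Type u'} [Category.{v'} D] [Abelian D]

/-- A monomorphism out of an injective object splits, so the identity of `F.obj X` factors through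
`F.map m = 0`. -/
theorem IsEffaceable.isZero_obj {F : C ⥤ D} [F.Additive] (hF : IsEffaceable F) (X : C)
    [Injective X] : IsZero (F.obj X) := by
  obtain ⟨M, m, hm, h⟩ := hF X
  rw [IsZero.iff_id_eq_zero, ← F.map_id, ← Injective.comp_factorThru (𝟙 X) m, F.map_comp, h,
    zero_comp]

/-- The sequence `X ⟶ Y ⟶ Z ⟶ 0` is exact. -/
def IsRightExact {X Y Z : D} (f : X ⟶ Y) (g : Y ⟶ Z) : Prop :=
  ∃ w : f ≫ g = 0, Epi g ∧ (ShortComplex.mk f g w).Exact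

theorem IsRightExact.comp_iso {X Y Z Z' : D} {f : X ⟶ Y} {g : Y ⟶ Z} (h : IsRightExact f g)
    (e : Z ≅ Z') : IsRightExact f (g ≫ e.hom) := by
  obtain ⟨w, hg, h⟩ := h
  refine ⟨by rw [← Category.assoc, w, zero_comp], epi_comp _ _, ?_⟩
  exact ShortComplex.exact_of_iso (ShortComplex.isoMk (S₁ := ShortComplex.mk f g w)
    (S₂ := ShortComplex.mk f (g ≫ e.hom) _) (Iso.refl _) (Iso.refl _) e
    ((Category.id_comp _).trans (Category.comp_id _).symm) (Category.id_comp _)) h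

theorem IsRightExact.iso_comp {X Y Y' Z : D} {f : X ⟶ Y} {g : Y ⟶ Z} (h : IsRightExact f g)
    (e : Y' ≅ Y) {f' : X ⟶ Y'} (hf : f' ≫ e.hom = f) : IsRightExact f' (e.hom ≫ g) := by
  obtain ⟨w, hg, h⟩ := h
  refine ⟨by rw [← Category.assoc, hf, w], epi_comp _ _, ?_⟩
  exact ShortComplex.exact_of_iso (ShortComplex.isoMk (S₁ := ShortComplex.mk f g w)
    (S₂ := ShortComplex.mk f' (e.hom ≫ g) _) (Iso.refl _) e.symm (Iso.refl _)
    ((Category.id_comp _).trans ((Iso.eq_comp_inv e).2 hf))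
    ((Iso.inv_hom_id_assoc e g).trans (Category.comp_id _).symm)) h

/-- Both targets are cokernels of `f`. The comparison is compatible with the projections, which
later yields naturality. -/
theorem IsRightExact.exists_iso {X Y Z Z' : D} {f : X ⟶ Y} {g : Y ⟶ Z} {g' : Y ⟶ Z'}
    (h : IsRightExact f g) (h' : IsRightExact f g') : ∃ e : Z ≅ Z', g ≫ e.hom = g' := by
  obtain ⟨w, h₁, h₂⟩ := h
  obtain ⟨w', h₁', h₂'⟩ := h'
  refine ⟨h₂.gIsCokernel.coconePointUniqueUpToIso h₂'.gIsCokernel, ?_⟩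
  exact h₂.gIsCokernel.comp_coconePointUniqueUpToIso_hom h₂'.gIsCokernel WalkingParallelPair.one

/-- A sequence of short exact sequences `0 ⟶ Z n ⟶ I n ⟶ Z (n + 1) ⟶ 0`. -/
structure SplicedSequence (C : Type u) [Category.{v} C] [Abelian C] where
  Z : ℕ → C
  I : ℕ → C
  i (n : ℕ) : Z n ⟶ I n
  p (n : ℕ) : I n ⟶ Z (n + 1)
  zero (n : ℕ) : i n ≫ p n = 0
  shortExact (n : ℕ) : (ShortComplex.mk (i n) (p n) (zero n)).ShortExact

namespace SplicedSequence

/-- Morphisms of sequences of short exact sequences. -/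
structure Hom (R R' : SplicedSequence C) where
  Z (n : ℕ) : R.Z n ⟶ R'.Z n
  I (n : ℕ) : R.I n ⟶ R'.I n
  comm_i (n : ℕ) : Z n ≫ R'.i n = R.i n ≫ I n
  comm_p (n : ℕ) : I n ≫ R'.p n = R.p n ≫ Z (n + 1)

/-- The sequence without its first term. -/
def shift (R : SplicedSequence C) : SplicedSequence C where
  Z n := R.Z (n + 1)
  I n := R.I (n + 1)
  i n := R.i (n + 1)
  p n := R.p (n + 1)
  zero n := R.zero (n + 1)
  shortExact n := R.shortExact (n + 1)

/-- The morphism induced on the sequences without their first terms. -/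
def Hom.shift {R R' : SplicedSequence C} (f : R.Hom R') : R.shift.Hom R'.shift where
  Z n := f.Z (n + 1)
  I n := f.I (n + 1)
  comm_i n := f.comm_i (n + 1)
  comm_p n := f.comm_p (n + 1)

variable {T : ℕ → C ⥤ D} [∀ n, (T n).Additive]

/-- The connecting morphism of the first short exact sequence. -/
def firstδ (P : ConnectedSequence T) (n : ℕ) (R : SplicedSequence C) :
    (T n).obj (R.shift.Z 0) ⟶ (T (n + 1)).obj (R.Z 0) :=
  P.δ n (R.shortExact 0)

/-- The iterated connecting morphism. -/
def iteratedδ (P : ConnectedSequence T) :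
    ∀ (n : ℕ) (R : SplicedSequence C), (T 0).obj (R.Z n) ⟶ (T n).obj (R.Z 0)
  | 0, R => 𝟙 ((T 0).obj (R.Z 0))
  | n + 1, R => iteratedδ P n R.shift ≫ R.firstδ P n

theorem iteratedδ_naturality (P : ConnectedSequence T) (n : ℕ) {R R' : SplicedSequence C}
    (f : R.Hom R') : (T 0).map (f.Z n) ≫ iteratedδ P n R' =
      iteratedδ P n R ≫ (T n).map (f.Z 0) := by
  induction n generalizing R R' with
  | zero => exact (Category.comp_id _).trans (Category.id_comp _).symm
  | succ n ih =>
    have h : (T n).map (f.shift.Z 0) ≫ R'.firstδ P n = R.firstδ P n ≫ (T (n + 1)).map (f.Z 0) :=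
      P.δ_naturality n (R.shortExact 0) (R'.shortExact 0)
        { τ₁ := f.Z 0, τ₂ := f.I 0, τ₃ := f.Z 1, comm₁₂ := f.comm_i 0, comm₂₃ := f.comm_p 0 }
    change (T 0).map (f.shift.Z n) ≫ iteratedδ P n R'.shift ≫ R'.firstδ P n =
      (iteratedδ P n R.shift ≫ R.firstδ P n) ≫ (T (n + 1)).map (f.Z 0)
    rw [Category.assoc, ← h, ← Category.assoc, ih f.shift, Category.assoc]

theorem isIso_δ (P : DeltaFunctor T) (n : ℕ) {S : ShortComplex C} (hS : S.ShortExact)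
    (h : IsZero ((T n).obj S.X₂)) (h' : IsZero ((T (n + 1)).obj S.X₂)) : IsIso (P.δ n hS) := by
  have := P.epi_δ n hS (h'.eq_of_tgt _ _)
  have : Mono (P.δ n hS) := (P.exact₃ n hS).mono_g (h.eq_of_src _ _)
  exact isIso_of_mono_of_epi _

/-- Dimension shifting: the connecting morphism from degree zero to degree one is a cokernel, and
all later ones are isomorphisms because the `R.I m` are acyclic. -/
theorem isRightExact_iteratedδ (P : DeltaFunctor T) (n : ℕ) (R : SplicedSequence C)
    (hR : ∀ k m, IsZero ((T (k + 1)).obj (R.I m))) :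
    IsRightExact ((T 0).map (R.p n)) (iteratedδ P.toConnectedSequence (n + 1) R) := by
  induction n generalizing R with
  | zero =>
    have h : iteratedδ P.toConnectedSequence 1 R = P.δ 0 (R.shortExact 0) := Category.id_comp _
    rw [h]
    exact ⟨P.comp_δ 0 (R.shortExact 0), P.epi_δ 0 (R.shortExact 0) ((hR 0 0).eq_of_tgt _ _),
      P.exact₃ 0 (R.shortExact 0)⟩
  | succ n ih =>
    have : IsIso (R.firstδ P.toConnectedSequence (n + 1)) :=
      isIso_δ P _ (R.shortExact 0) (hR n 0) (hR (n + 1) 0)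
    exact (ih R.shift fun k m => hR k (m + 1)).comp_iso
      (asIso (R.firstδ P.toConnectedSequence (n + 1)))

end SplicedSequence

namespace CategoryTheory.InjectiveResolution

/-- The short exact sequences of cocycles of an injective resolution. -/
noncomputable def splicedSequence {X : C} (I : InjectiveResolution X) : SplicedSequence C where
  Z n := I.cocomplex.cycles n
  I n := I.cocomplex.X n
  i n := I.cocomplex.iCycles n
  p n := I.cocomplex.toCycles n (n + 1)
  zero n := by rw [← cancel_mono (I.cocomplex.iCycles (n + 1))]; simp
  shortExact n :=
    { exact := by
        refine ShortComplex.exact_of_f_is_kernel _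
          (KernelFork.IsLimit.ofι' _ _ fun {A} (k : A ⟶ I.cocomplex.X n)
            (hk : k ≫ I.cocomplex.toCycles n (n + 1) = 0) => ?_)
        have hk' : k ≫ I.cocomplex.d n (n + 1) = 0 := by
          rw [← HomologicalComplex.toCycles_i, ← Category.assoc, hk, zero_comp]
        exact ⟨I.cocomplex.liftCycles k (n + 1) (by simp) hk',
          I.cocomplex.liftCycles_i _ _ _ _⟩
      mono_f := (inferInstance : Mono (I.cocomplex.iCycles n))
      -- The cokernel of `toCycles` is the cohomology in degree `n + 1`, which vanishes for a
      -- resolution.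
      epi_g := Preadditive.epi_of_isZero_cokernel' _
        (I.cocomplex.homologyIsCokernel n (n + 1) (by simp))
        ((I.cocomplex_exactAt_succ n).isZero_homology) }

/-- The morphism of cocycle sequences induced by a morphism of resolutions. -/
noncomputable def splicedSequenceHom {X Y : C} {I : InjectiveResolution X}
    {I' : InjectiveResolution Y} (φ : I.cocomplex ⟶ I'.cocomplex) :
    I.splicedSequence.Hom I'.splicedSequence where
  Z n := HomologicalComplex.cyclesMap φ n
  I n := φ.f n
  comm_i n := HomologicalComplex.cyclesMap_i _ _
  comm_p n := by
    dsimp only [splicedSequence]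
    rw [← cancel_mono (I'.cocomplex.iCycles (n + 1))]
    simp

/-- The embedding of `X` in the first object of an injective resolution. -/
def ι₀ {X : C} (I : InjectiveResolution X) : X ⟶ I.cocomplex.X 0 :=
  I.ι.f 0

theorem ι₀_d {X : C} (I : InjectiveResolution X) : I.ι₀ ≫ I.cocomplex.d 0 1 = 0 :=
  I.ι_f_zero_comp_complex_d

/-- The object `X` as the object of zero cocycles of an injective resolution. -/
noncomputable def toCyclesZero {X : C} (I : InjectiveResolution X) :
    X ⟶ I.cocomplex.cycles 0 :=
  I.cocomplex.liftCycles I.ι₀ 1 (by simp) I.ι₀_d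

theorem toCyclesZero_iCycles {X : C} (I : InjectiveResolution X) :
    I.toCyclesZero ≫ I.cocomplex.iCycles 0 = I.ι₀ := by
  dsimp only [toCyclesZero]
  rw [HomologicalComplex.liftCycles_i]

instance {X : C} (I : InjectiveResolution X) : IsIso I.toCyclesZero :=
  (CochainComplex.isIso_liftCycles_iff _ I.ι₀ I.ι₀_d).2
    ⟨I.exact₀, (inferInstance : Mono (I.ι.f 0))⟩

theorem toCyclesZero_naturality {X Y : C} (f : X ⟶ Y) (I : InjectiveResolution X)
    (I' : InjectiveResolution Y) (φ : I.cocomplex ⟶ I'.cocomplex)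
    (comm : I.ι₀ ≫ φ.f 0 = f ≫ I'.ι₀) :
    f ≫ I'.toCyclesZero = I.toCyclesZero ≫ HomologicalComplex.cyclesMap φ 0 := by
  rw [← cancel_mono (I'.cocomplex.iCycles 0), Category.assoc, toCyclesZero_iCycles, Category.assoc,
    HomologicalComplex.cyclesMap_i, reassoc_of% toCyclesZero_iCycles, comm]

end CategoryTheory.InjectiveResolution

section MapCycles

variable (G : C ⥤ D) [G.Additive] (K : CochainComplex C ℕ)

/-- The complex obtained by applying an additive functor. -/
noncomputable abbrev mapComplex : CochainComplex D ℕ :=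
  (G.mapHomologicalComplex (ComplexShape.up ℕ)).obj K

/-- The image of the inclusion of cocycles. -/
noncomputable def mapICycles (n : ℕ) : G.obj (K.cycles n) ⟶ (mapComplex G K).X n :=
  G.map (K.iCycles n)

/-- The image of the differential, with values in cocycles. -/
noncomputable def mapToCycles (n : ℕ) : (mapComplex G K).X n ⟶ G.obj (K.cycles (n + 1)) :=
  G.map (K.toCycles n (n + 1))

theorem mapICycles_d (n : ℕ) : mapICycles G K n ≫ (mapComplex G K).d n (n + 1) = 0 :=
  (G.map_comp _ _).symm.trans ((congrArg G.map (K.iCycles_d n (n + 1))).trans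
    (G.map_zero _ _))

theorem mapToCycles_mapICycles (n : ℕ) :
    mapToCycles G K n ≫ mapICycles G K (n + 1) = (mapComplex G K).d n (n + 1) :=
  (G.map_comp _ _).symm.trans (congrArg G.map (K.toCycles_i n (n + 1)))

/-- A left exact functor preserves the kernel of `d`; hence taking cocycles commutes with `G`. -/
theorem exact_mapICycles [PreservesFiniteLimits G] (n : ℕ) :
    (ShortComplex.mk _ _ (mapICycles_d G K n)).Exact :=
  ShortComplex.exact_of_f_is_kernel _
    (KernelFork.mapIsLimit _ (K.cyclesIsKernel n (n + 1) (by simp)) G)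

instance [PreservesFiniteLimits G] (n : ℕ) : Mono (mapICycles G K n) :=
  inferInstanceAs (Mono (G.map (K.iCycles n)))

/-- The comparison of the image of cocycles with the cocycles of the image. -/
noncomputable def mapCyclesIso [PreservesFiniteLimits G] (n : ℕ) :
    G.obj (K.cycles n) ≅ (mapComplex G K).cycles n where
  hom := (mapComplex G K).liftCycles (mapICycles G K n) (n + 1) (by simp) (mapICycles_d G K n)
  inv :=
    haveI : Mono (ShortComplex.mk _ _ (mapICycles_d G K n)).f :=
      inferInstanceAs (Mono (mapICycles G K n))
    (exact_mapICycles G K n).lift ((mapComplex G K).iCycles n)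
      (HomologicalComplex.iCycles_d _ _ _)
  hom_inv_id := by
    have : Mono (ShortComplex.mk _ _ (mapICycles_d G K n)).f :=
      inferInstanceAs (Mono (mapICycles G K n))
    rw [← cancel_mono (mapICycles G K n), Category.assoc, Category.id_comp]
    refine (congrArg _ ((exact_mapICycles G K n).lift_f _ _)).trans ?_
    exact HomologicalComplex.liftCycles_i _ _ _ _ _
  inv_hom_id := by
    have : Mono (ShortComplex.mk _ _ (mapICycles_d G K n)).f :=
      inferInstanceAs (Mono (mapICycles G K n))
    rw [← cancel_mono ((mapComplex G K).iCycles n), Category.assoc,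
      HomologicalComplex.liftCycles_i, Category.id_comp]
    exact (exact_mapICycles G K n).lift_f _ _

variable [PreservesFiniteLimits G]

theorem mapCyclesIso_hom_iCycles (n : ℕ) :
    (mapCyclesIso G K n).hom ≫ (mapComplex G K).iCycles n = mapICycles G K n := by
  dsimp only [mapCyclesIso]
  rw [HomologicalComplex.liftCycles_i]

theorem mapToCycles_mapCyclesIso (n : ℕ) :
    mapToCycles G K n ≫ (mapCyclesIso G K (n + 1)).hom = (mapComplex G K).toCycles n (n + 1) := by
  rw [← cancel_mono ((mapComplex G K).iCycles (n + 1)), Category.assoc, mapCyclesIso_hom_iCycles,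
    HomologicalComplex.toCycles_i, mapToCycles_mapICycles]

omit [PreservesFiniteLimits G] in
theorem mapICycles_naturality {K L : CochainComplex C ℕ} (φ : K ⟶ L) (n : ℕ) :
    G.map (HomologicalComplex.cyclesMap φ n) ≫ mapICycles G L n =
      mapICycles G K n ≫ ((G.mapHomologicalComplex (ComplexShape.up ℕ)).map φ).f n :=
  (G.map_comp _ _).symm.trans ((congrArg G.map (HomologicalComplex.cyclesMap_i φ n)).trans
    (G.map_comp _ _))

theorem mapCyclesIso_naturality {K L : CochainComplex C ℕ} (φ : K ⟶ L) (n : ℕ) :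
    G.map (HomologicalComplex.cyclesMap φ n) ≫ (mapCyclesIso G L n).hom =
      (mapCyclesIso G K n).hom ≫ HomologicalComplex.cyclesMap
        ((G.mapHomologicalComplex (ComplexShape.up ℕ)).map φ) n := by
  rw [← cancel_mono ((mapComplex G L).iCycles n), Category.assoc, mapCyclesIso_hom_iCycles,
    Category.assoc, HomologicalComplex.cyclesMap_i, reassoc_of% mapCyclesIso_hom_iCycles,
    mapICycles_naturality]

/-- The morphism from the image of cocycles to the cohomology of the image. -/
noncomputable def mapCyclesToHomology (n : ℕ) :
    G.obj (K.cycles n) ⟶ (mapComplex G K).homology n :=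
  (mapCyclesIso G K n).hom ≫ HomologicalComplex.homologyπ _ n

theorem mapCyclesToHomology_naturality {K L : CochainComplex C ℕ} (φ : K ⟶ L) (n : ℕ) :
    G.map (HomologicalComplex.cyclesMap φ n) ≫ mapCyclesToHomology G L n =
      mapCyclesToHomology G K n ≫ HomologicalComplex.homologyMap
        ((G.mapHomologicalComplex (ComplexShape.up ℕ)).map φ) n := by
  dsimp only [mapCyclesToHomology]
  rw [Category.assoc, HomologicalComplex.homologyπ_naturality, ← Category.assoc,
    mapCyclesIso_naturality, Category.assoc]

theorem isRightExact_mapCyclesToHomology (n : ℕ) :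
    IsRightExact (mapToCycles G K n) (mapCyclesToHomology G K (n + 1)) := by
  have h : IsRightExact ((mapComplex G K).toCycles n (n + 1))
      ((mapComplex G K).homologyπ (n + 1)) :=
    ⟨HomologicalComplex.toCycles_comp_homologyπ _ _ _, inferInstance,
      ShortComplex.exact_of_g_is_cokernel _
        (HomologicalComplex.homologyIsCokernel _ n (n + 1) (by simp))⟩
  exact h.iso_comp (mapCyclesIso G K (n + 1)) (mapToCycles_mapCyclesIso G K n)

end MapCycles

/-- Right derived functors as cohomology of the image of an injective resolution. -/
noncomputable def CategoryTheory.InjectiveResolution.rightDerivedObjIso [HasInjectiveResolutions C]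
    {X : C} (I : InjectiveResolution X) (G : C ⥤ D) [G.Additive] (n : ℕ) :
    (G.rightDerived n).obj X ≅ (mapComplex G I.cocomplex).homology n :=
  I.isoRightDerivedObj G n

theorem CategoryTheory.InjectiveResolution.rightDerivedObjIso_hom_naturality
    [HasInjectiveResolutions C] {X Y : C} (f : X ⟶ Y) (I : InjectiveResolution X)
    (I' : InjectiveResolution Y) (φ : I.cocomplex ⟶ I'.cocomplex)
    (comm : I.ι₀ ≫ φ.f 0 = f ≫ I'.ι₀) (G : C ⥤ D) [G.Additive] (n : ℕ) :
    (G.rightDerived n).map f ≫ (I'.rightDerivedObjIso G n).hom =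
      (I.rightDerivedObjIso G n).hom ≫ HomologicalComplex.homologyMap
        ((G.mapHomologicalComplex (ComplexShape.up ℕ)).map φ) n :=
  InjectiveResolution.isoRightDerivedObj_hom_naturality f I I' φ comm G n

/-- A `δ`-functor which is effaceable in positive degrees is computed by injective resolutions. -/
theorem DeltaFunctor.nonempty_rightDerived_iso [HasInjectiveResolutions C] {T : ℕ → C ⥤ D}
    [∀ n, (T n).Additive] (P : DeltaFunctor T) (hT : ∀ n, IsEffaceable (T (n + 1)))
    [PreservesFiniteLimits (T 0)] (n : ℕ) : Nonempty ((T 0).rightDerived n ≅ T n) := by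
  obtain _ | n := n
  · exact ⟨(T 0).rightDerivedZeroIsoSelf⟩
  let I : ∀ X : C, InjectiveResolution X := fun X => injectiveResolution X
  -- Both objects are cokernels of `T 0` applied to the map from the `n`-th term of the resolution
  -- to the cocycles in degree `n + 1`.
  have H : ∀ X : C, ∃ e : (mapComplex (T 0) (I X).cocomplex).homology (n + 1) ≅
        (T (n + 1)).obj ((I X).cocomplex.cycles 0),
      mapCyclesToHomology (T 0) (I X).cocomplex (n + 1) ≫ e.hom =
        SplicedSequence.iteratedδ P.toConnectedSequence (n + 1) (I X).splicedSequence :=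
    fun X => (isRightExact_mapCyclesToHomology (T 0) (I X).cocomplex n).exists_iso
      (SplicedSequence.isRightExact_iteratedδ P n (I X).splicedSequence
        fun k m => haveI := (I X).injective m; (hT k).isZero_obj ((I X).cocomplex.X m))
  choose e he using H
  refine ⟨NatIso.ofComponents (fun X => (I X).rightDerivedObjIso (T 0) (n + 1) ≪≫ e X ≪≫
    (T (n + 1)).mapIso (asIso (I X).toCyclesZero).symm) fun {X Y} f => ?_⟩
  let φ := InjectiveResolution.desc f (I Y) (I X)
  have comm : (I X).ι₀ ≫ φ.f 0 = f ≫ (I Y).ι₀ := InjectiveResolution.desc_commutes_zero _ _ _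
  have h₁ := InjectiveResolution.rightDerivedObjIso_hom_naturality f (I X) (I Y) φ comm (T 0)
    (n + 1)
  -- Naturality is checked after the epimorphism from the image of the cocycles, where it becomes
  -- naturality of the iterated connecting morphism.
  have h₂ : HomologicalComplex.homologyMap
        (((T 0).mapHomologicalComplex (ComplexShape.up ℕ)).map φ) (n + 1) ≫ (e Y).hom =
      (e X).hom ≫ (T (n + 1)).map (HomologicalComplex.cyclesMap φ 0) := by
    have := (isRightExact_mapCyclesToHomology (T 0) (I X).cocomplex n).choose_spec.1
    rw [← cancel_epi (mapCyclesToHomology (T 0) (I X).cocomplex (n + 1)), ← Category.assoc,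
      ← Category.assoc, he X, ← mapCyclesToHomology_naturality, Category.assoc, he Y]
    exact SplicedSequence.iteratedδ_naturality P.toConnectedSequence (n + 1)
      (InjectiveResolution.splicedSequenceHom φ)
  have h₃ : HomologicalComplex.cyclesMap φ 0 ≫ inv (I Y).toCyclesZero =
      inv (I X).toCyclesZero ≫ f := by
    rw [IsIso.comp_inv_eq, Category.assoc, IsIso.eq_inv_comp]
    exact (InjectiveResolution.toCyclesZero_naturality f (I X) (I Y) φ comm).symm
  simp only [Iso.trans_hom, Functor.mapIso_hom, Iso.symm_hom, asIso_inv, Category.assoc]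
  rw [← Functor.map_comp, ← h₃, Functor.map_comp, ← Category.assoc, h₁, Category.assoc,
    ← Category.assoc (HomologicalComplex.homologyMap _ _), h₂, Category.assoc]

theorem DeltaFunctor.nonempty_rightDerived_iso_of_iso [HasInjectiveResolutions C]
    {T : ℕ → C ⥤ D} [∀ n, (T n).Additive] (P : DeltaFunctor T)
    (hT : ∀ n, IsEffaceable (T (n + 1))) {F : C ⥤ D} [F.Additive] [PreservesFiniteLimits F]
    (e : T 0 ≅ F) (n : ℕ) : Nonempty (F.rightDerived n ≅ T n) := by
  have : PreservesFiniteLimits (T 0) := preservesFiniteLimits_of_natIso e.symm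
  obtain ⟨e'⟩ := P.nonempty_rightDerived_iso hT n
  exact ⟨⟨NatTrans.rightDerived e.inv n, NatTrans.rightDerived e.hom n,
    by rw [← NatTrans.rightDerived_comp, e.inv_hom_id, NatTrans.rightDerived_id],
    by rw [← NatTrans.rightDerived_comp, e.hom_inv_id, NatTrans.rightDerived_id]⟩ ≪≫ e'⟩

end InjectiveResolutions

/-! ### The main theorem -/

theorem mainTheorem7 (κ : Cardinal.{w}) (hκ : Cardinal.aleph0 ≤ κ)
    (J : Type w) [SmallCategory J] (hJ : HasCardinalLT (Arrow J) κ)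
    (A : Type u) [Category.{v} A] [Abelian A] (hA : SatisfiesAB4Star κ A) :
    haveI : HasLimitsOfShape Jᵒᵖ A := hA.hasLimitsOfShape_op hJ
    haveI : ∀ n, HasProductsOfShape (ComposableArrows J n) A :=
      hA.hasProductsOfShape_composableArrows hκ hJ
    -- the Roos complex sends short exact sequences to short exact sequences of complexes
    ∃ (hN : ∀ {S : ShortComplex (Jᵒᵖ ⥤ A)}, S.ShortExact → (S.map (roosComplex J A)).ShortExact)
      -- the cohomology of the Roos complex has the structure of right derived functors of `lim`,
      (R : RightDerivedFunctors (lim : (Jᵒᵖ ⥤ A) ⥤ A) (roosCohomology J A)),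
      -- with connecting morphisms given by the long exact cohomology sequence,
      (∀ (n : ℕ) {S : ShortComplex (Jᵒᵖ ⥤ A)} (hS : S.ShortExact),
        R.δ n hS = (hN hS).δ n (n + 1) rfl) ∧
      -- it is effaceable in positive degrees,
      (∀ n : ℕ, IsEffaceable (roosCohomology J A (n + 1))) ∧
      -- any right derived functors of `lim` are uniquely isomorphic to it,
      (∀ (L : ℕ → (Jᵒᵖ ⥤ A) ⥤ A) [∀ n, (L n).Additive]
        (R' : RightDerivedFunctors (lim : (Jᵒᵖ ⥤ A) ⥤ A) L),
        ∃! e : ∀ n, L n ≅ roosCohomology J A n,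
          (e 0).hom ≫ R.iso₀.hom = R'.iso₀.hom ∧
          R'.toConnectedSequence.IsMorphism R.toConnectedSequence (fun n => (e n).hom)) ∧
      -- and so are the derived functors computed by injective resolutions, if these exist.
      (∀ [HasInjectiveResolutions (Jᵒᵖ ⥤ A)] (n : ℕ),
        Nonempty ((lim : (Jᵒᵖ ⥤ A) ⥤ A).rightDerived n ≅ roosCohomology J A n)) := by

  have : HasLimitsOfShape Jᵒᵖ A := hA.hasLimitsOfShape_op hJ
  have : ∀ n, HasProductsOfShape (ComposableArrows J n) A :=
    hA.hasProductsOfShape_composableArrows hκ hJ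
  have hN : ∀ {S : ShortComplex (Jᵒᵖ ⥤ A)}, S.ShortExact →
      (S.map (roosComplex J A)).ShortExact := fun hS => hA.shortExact_map_roosComplex hκ hJ hS
  have := fun j => hA.hasProductsOfShape_over hJ j
  have hE : ∀ n : ℕ, IsEffaceable (roosCohomology J A (n + 1)) := isEffaceable_roosCohomology
  let P : DeltaFunctor (roosCohomology J A) := roosDeltaFunctor hN
  let R : RightDerivedFunctors (lim : (Jᵒᵖ ⥤ A) ⥤ A) (roosCohomology J A) :=
    { toDeltaFunctor := P
      universal := P.isUniversal hE
      iso₀ := roosCohomologyZeroIso }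
  refine ⟨hN, R, fun _ _ _ => rfl, hE, fun L _ R' => R'.existsUnique_iso R, fun n => ?_⟩
  exact P.nonempty_rightDerived_iso_of_iso hE roosCohomologyZeroIso n
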